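/- Let $X=\{0,1\}$, let $\operatorname{Aut}X^*$ be the automorphism group of the infinite binary rooted tree $X^*$, acting on the right ($gh$ means first $g$, then $h$), and write $g|_v\in\operatorname{Aut}X^*$ for the state of $g$ at the vertex $v$, so that $(vw)^g=v^g\,w^{(g|_v)}$ for all words $w$. Let $\operatorname{Stab}(n)$ be the subgroup of $\operatorname{Aut}X^*$ fixing all words of length $n$, and $\operatorname{Aut}X^n=\operatorname{Aut}X^*/\operatorname{Stab}(n)$, which acts on the set $X^n$ of words of length $n$. For a group $H$ let $H\wr\operatorname{Aut}X^n=H^{X^n}\rtimes\operatorname{Aut}X^n$ be the permutational wreath product. Let $a$ be the automorphism that swaps the two maximal subtrees, $(xw)^a=(1-x)w$, and define $b,c,d$ (fixing both words of length $1$) recursively by their pairs of states at $0$ and $1$: $$b=(c,a),\qquad c=(a,d),\qquad d=(1,b).$$ Let $G=\langle a,b,c,d\rangle\le\operatorname{Aut}X^*$; every state of an element of $G$ lies in $G$. With $[x,y]=x^{-1}y^{-1}xy$, let $K$ be the normal closure in $G$ of $\{[a,b],[b,c],[b,d],[c,d],bcd\}$, let $C$ be the (normal) subgroup of $G$ generated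 by $[K,G]$ and $[a,b][b,c]$, and let $\Gamma=G/C$. For $n\ge0$ let $$\pi_n:G\to\Gamma\wr\operatorname{Aut}X^n,\qquad g\mapsto\bigl((g|_v\,C)_{v\in X^n},\ g\operatorname{Stab}(n)\bigr).$$ **Theorem.** Let $f:G\to Q$ be an epimorphism onto a finite group. Then there is $N$ such that for every $n\ge N$ the map $f$ factors through $\pi_n$, that is, there is a homomorphism $h:\pi_n(G)\to Q$ with $f=h\circ\pi_n$. -/

import Mathlib

namespace TwistedTwin

/-- An automorphism of the infinite binary rooted tree `X*`, `X = {0, 1}`. Vertices are the finite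
words over `Bool` (with `false = 0`, `true = 1`); `u` is an ancestor of `v` iff `u` is a prefix of
`v`. -/
@[ext]
structure TreeAut where
  toEquiv : List Bool ≃ List Bool
  length_map : ∀ w, (toEquiv w).length = w.length
  prefix_map : ∀ u v, toEquiv u <+: toEquiv v ↔ u <+: v

namespace TreeAut

/-- The image `v ^ g` of the vertex `v` under `g`. -/
def act (g : TreeAut) (v : List Bool) : List Bool := g.toEquiv v

/-- Automorphisms act on the right: in the product `g * h`, first `g` and then `h` is applied. -/
instance : Mul TreeAut where
  mul g h := ⟨g.toEquiv.trans h.toEquiv,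
    fun w => by simp [g.length_map, h.length_map],
    fun u v => by simp [g.prefix_map, h.prefix_map]⟩

instance : One TreeAut where
  one := ⟨Equiv.refl _, fun _ => rfl, fun _ _ => Iff.rfl⟩

instance : Inv TreeAut where
  inv g := ⟨g.toEquiv.symm,
    fun w => by rw [← g.length_map]; simp,
    fun u v => by rw [← g.prefix_map]; simp⟩

theorem act_injective (g : TreeAut) : Function.Injective g.act := g.toEquiv.injective

theorem ext_act {g h : TreeAut} (H : ∀ w, g.act w = h.act w) : g = h :=
  TreeAut.ext (Equiv.ext H)

theorem act_mul (g h : TreeAut) (w : List Bool) : (g * h).act w = h.act (g.act w) := rfl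

theorem act_one (w : List Bool) : (1 : TreeAut).act w = w := rfl

theorem act_inv_act (g : TreeAut) (w : List Bool) : g⁻¹.act (g.act w) = w :=
  g.toEquiv.symm_apply_apply w

theorem act_act_inv (g : TreeAut) (w : List Bool) : g.act (g⁻¹.act w) = w :=
  g.toEquiv.apply_symm_apply w

instance : Group TreeAut :=
  Group.ofLeftAxioms (fun _ _ _ => rfl) (fun _ => rfl) (fun g => ext_act (g.act_act_inv))

theorem length_act (g : TreeAut) (w : List Bool) : (g.act w).length = w.length := g.length_map w

theorem act_prefix_act (g : TreeAut) (u v : List Bool) : g.act u <+: g.act v ↔ u <+: v :=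
  g.prefix_map u v

/-- The action of `g` on words with prefix `v`, with the image of the prefix removed. -/
def stateFun (g : TreeAut) (v w : List Bool) : List Bool := (g.act (v ++ w)).drop v.length

theorem act_append (g : TreeAut) (v w : List Bool) :
    g.act (v ++ w) = g.act v ++ g.stateFun v w := by
  obtain ⟨t, ht⟩ := (g.act_prefix_act v (v ++ w)).2 (List.prefix_append v w)
  rw [stateFun, ← ht, ← g.length_act v, List.drop_left]

theorem stateFun_inv (g : TreeAut) (v w : List Bool) :
    g⁻¹.stateFun (g.act v) (g.stateFun v w) = w := by
  have h := g.act_inv_act (v ++ w)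
  rw [act_append, act_append, act_inv_act] at h
  exact List.append_cancel_left h

/-- The state `g|_v` of `g` at the vertex `v`: the automorphism with
`(v w) ^ g = (v ^ g) (w ^ (g|_v))` for all words `w`. -/
def state (g : TreeAut) (v : List Bool) : TreeAut where
  toEquiv :=
    { toFun := g.stateFun v
      invFun := g⁻¹.stateFun (g.act v)
      left_inv := g.stateFun_inv v
      right_inv := fun w => by
        have h := g⁻¹.stateFun_inv (g.act v) w
        rwa [inv_inv, act_inv_act] at h }
  length_map w := by
    have h := congrArg List.length (g.act_append v w)
    simp only [length_act, List.length_append] at h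
    simp only [Equiv.coe_fn_mk]
    omega
  prefix_map u w := by
    simp only [Equiv.coe_fn_mk]
    rw [← List.prefix_append_right_inj (g.act v), ← act_append, ← act_append, act_prefix_act,
      List.prefix_append_right_inj]

theorem act_append_state (g : TreeAut) (v w : List Bool) :
    g.act (v ++ w) = g.act v ++ (g.state v).act w := g.act_append v w

theorem state_eq_of {g h : TreeAut} {v : List Bool}
    (H : ∀ w, g.act (v ++ w) = g.act v ++ h.act w) : g.state v = h :=
  ext_act fun w => List.append_cancel_left ((g.act_append_state v w).symm.trans (H w))

theorem state_one (v : List Bool) : (1 : TreeAut).state v = 1 := state_eq_of fun _ => rfl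

theorem state_nil (g : TreeAut) : g.state [] = g := state_eq_of fun w => by
  rw [List.eq_nil_of_length_eq_zero (g.length_act [])]; rfl

theorem state_mul (g h : TreeAut) (v : List Bool) :
    (g * h).state v = g.state v * h.state (g.act v) := state_eq_of fun w => by
  rw [act_mul, act_append_state, act_append_state, act_mul, act_mul]

theorem state_inv (g : TreeAut) (v : List Bool) :
    g⁻¹.state v = (g.state (g⁻¹.act v))⁻¹ := by
  rw [eq_inv_iff_mul_eq_one, ← state_mul, inv_mul_cancel, state_one]

theorem state_append (g : TreeAut) (u v : List Bool) :
    g.state (u ++ v) = (g.state u).state v := state_eq_of fun w => by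
  rw [List.append_assoc, act_append_state, act_append_state, act_append_state, List.append_assoc]

end TreeAut

open TreeAut

/-! ### Stabilizers, finite levels, wreath products -/

/-- The `n`-th level stabilizer `Stab(n)` in `Aut X*`. -/
def levelStab (n : ℕ) : Subgroup TreeAut where
  carrier := {g | ∀ w : List Bool, w.length = n → g.act w = w}
  one_mem' _ _ := rfl
  mul_mem' {g h} hg hh w hw := by rw [act_mul, hg w hw, hh w hw]
  inv_mem' {g} hg w hw := by
    have h := g.act_inv_act w
    rwa [hg w hw] at h

instance levelStab_normal (n : ℕ) : (levelStab n).Normal where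
  conj_mem g hg h w hw := by
    rw [act_mul, act_mul, hg _ ((h.length_act w).trans hw), act_inv_act]

/-- The finite group `Aut X^n = Aut X* / Stab(n)`. -/
abbrev AutLevel (n : ℕ) : Type := TreeAut ⧸ levelStab n

/-- The `n`-th level `X^n` of the tree. -/
abbrev Level (n : ℕ) : Type := {w : List Bool // w.length = n}

/-- The action of a tree automorphism on the `n`-th level. -/
def TreeAut.actLevel {n : ℕ} (g : TreeAut) (v : Level n) : Level n :=
  ⟨g.act v.1, (g.length_act v.1).trans v.2⟩

/-- `Aut X*` permutes the coordinates of `H^{X^n}`: `(σ · f)(v) = f (v ^ σ)`. -/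
def permCoords (H : Type*) [Group H] (n : ℕ) : TreeAut →* MulAut (Level n → H) where
  toFun g :=
    { toFun := fun f v => f (g.actLevel v)
      invFun := fun f v => f (g⁻¹.actLevel v)
      left_inv := fun f => funext fun v => congrArg f (Subtype.ext (g.act_act_inv v.1))
      right_inv := fun f => funext fun v => congrArg f (Subtype.ext (g.act_inv_act v.1))
      map_mul' := fun _ _ => rfl }
  map_one' := rfl
  map_mul' _ _ := rfl

/-- The action of `Aut X^n` on `H^{X^n}` by permutation of the coordinates. -/
def wreathAction (H : Type*) [Group H] (n : ℕ) : AutLevel n →* MulAut (Level n → H) :=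
  QuotientGroup.lift (levelStab n) (permCoords H n) fun _ hg =>
    MulEquiv.ext fun f => funext fun v => congrArg f (Subtype.ext (hg v.1 v.2))

/-- The permutational wreath product `H ≀ Aut X^n = H^{X^n} ⋊ Aut X^n`. -/
abbrev Wreath (H : Type*) [Group H] (n : ℕ) : Type _ :=
  SemidirectProduct (Level n → H) (AutLevel n) (wreathAction H n)

/-- A homomorphism `H → H'` applied to each coordinate of the wreath product. -/
def Wreath.map {H H' : Type*} [Group H] [Group H'] (q : H →* H') (n : ℕ) :
    Wreath H n →* Wreath H' n :=
  SemidirectProduct.map (MonoidHom.compLeft q (Level n)) (MonoidHom.id (AutLevel n))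
    (fun σ => by
      induction σ using QuotientGroup.induction_on with
      | H _ => rfl)

/-! ### The generators and the group `G` -/

/-- The action of `a`, the swap of the two maximal subtrees. -/
def aFun : List Bool → List Bool
  | [] => []
  | x :: w => (!x) :: w

mutual
/-- The action of `b`, where `ψ(b) = (c, a)`. -/
def bFun : List Bool → List Bool
  | [] => []
  | false :: w => false :: cFun w
  | true :: w => true :: aFun w
/-- The action of `c`, where `ψ(c) = (a, d)`. -/
def cFun : List Bool → List Bool
  | [] => []
  | false :: w => false :: aFun w
  | true :: w => true :: dFun w
/-- The action of `d`, where `ψ(d) = (1, b)`. -/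
def dFun : List Bool → List Bool
  | [] => []
  | false :: w => false :: w
  | true :: w => true :: bFun w
end

theorem aFun_aFun (w : List Bool) : aFun (aFun w) = w := by
  cases w <;> simp [aFun]

theorem bcd_invol (w : List Bool) :
    bFun (bFun w) = w ∧ cFun (cFun w) = w ∧ dFun (dFun w) = w := by
  induction w with
  | nil => simp [bFun, cFun, dFun]
  | cons x w ih => cases x <;> simp [bFun, cFun, dFun, aFun_aFun, ih]

theorem length_aFun (w : List Bool) : (aFun w).length = w.length := by
  cases w <;> simp [aFun]

theorem bcd_length (w : List Bool) : (bFun w).length = w.length ∧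
    (cFun w).length = w.length ∧ (dFun w).length = w.length := by
  induction w with
  | nil => simp [bFun, cFun, dFun]
  | cons x w ih => cases x <;> simp [bFun, cFun, dFun, length_aFun, ih]

theorem prefix_aFun (u v : List Bool) : aFun u <+: aFun v ↔ u <+: v := by
  cases u <;> cases v <;> simp [aFun, List.cons_prefix_cons]

theorem bcd_prefix (u v : List Bool) : (bFun u <+: bFun v ↔ u <+: v) ∧
    (cFun u <+: cFun v ↔ u <+: v) ∧ (dFun u <+: dFun v ↔ u <+: v) := by
  induction u generalizing v with
  | nil => simp [bFun, cFun, dFun]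
  | cons x u ih =>
    cases v with
    | nil => cases x <;> simp [bFun, cFun, dFun]
    | cons y v =>
      cases x <;> cases y <;> simp [bFun, cFun, dFun, List.cons_prefix_cons, prefix_aFun, ih v]

/-- The automorphism `a = σ`. -/
def a : TreeAut where
  toEquiv := ⟨aFun, aFun, aFun_aFun, aFun_aFun⟩
  length_map := length_aFun
  prefix_map := prefix_aFun

/-- The automorphism `b`, with `ψ(b) = (c, a)`. -/
def b : TreeAut where
  toEquiv := ⟨bFun, bFun, fun w => (bcd_invol w).1, fun w => (bcd_invol w).1⟩
  length_map w := (bcd_length w).1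
  prefix_map u v := (bcd_prefix u v).1

/-- The automorphism `c`, with `ψ(c) = (a, d)`. -/
def c : TreeAut where
  toEquiv := ⟨cFun, cFun, fun w => (bcd_invol w).2.1, fun w => (bcd_invol w).2.1⟩
  length_map w := (bcd_length w).2.1
  prefix_map u v := (bcd_prefix u v).2.1

/-- The automorphism `d`, with `ψ(d) = (1, b)`. -/
def d : TreeAut where
  toEquiv := ⟨dFun, dFun, fun w => (bcd_invol w).2.2, fun w => (bcd_invol w).2.2⟩
  length_map w := (bcd_length w).2.2
  prefix_map u v := (bcd_prefix u v).2.2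

theorem state_a (x : Bool) : a.state [x] = 1 := state_eq_of fun _ => rfl

theorem state_b_false : b.state [false] = c := state_eq_of fun w => by
  simp [act, b, c, bFun, cFun]

theorem state_b_true : b.state [true] = a := state_eq_of fun w => by
  simp [act, b, a, bFun, aFun]

theorem state_c_false : c.state [false] = a := state_eq_of fun w => by
  simp [act, c, a, cFun, aFun]

theorem state_c_true : c.state [true] = d := state_eq_of fun w => by
  simp [act, c, d, cFun, dFun]

theorem state_d_false : d.state [false] = 1 := state_eq_of fun w => by
  simp [act, d, dFun]
  rfl

theorem state_d_true : d.state [true] = b := state_eq_of fun w => by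
  simp [act, d, b, dFun, bFun]

/-- The twisted twin `G` of the Grigorchuk group. -/
def G : Subgroup TreeAut := Subgroup.closure {a, b, c, d}

theorem a_mem : a ∈ G := Subgroup.subset_closure (by simp)
theorem b_mem : b ∈ G := Subgroup.subset_closure (by simp)
theorem c_mem : c ∈ G := Subgroup.subset_closure (by simp)
theorem d_mem : d ∈ G := Subgroup.subset_closure (by simp)

theorem state_letter_mem {g : TreeAut} (hg : g ∈ G) : ∀ x : Bool, g.state [x] ∈ G := by
  have key : ∀ v : List Bool, v.length = 1 → g.state v ∈ G := by
    induction hg using Subgroup.closure_induction with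
    | mem g hg =>
      intro v hv
      obtain ⟨x, rfl⟩ := List.length_eq_one_iff.1 hv
      rcases hg with rfl | rfl | rfl | rfl
      · rw [state_a]; exact one_mem _
      · cases x
        · rw [state_b_false]; exact c_mem
        · rw [state_b_true]; exact a_mem
      · cases x
        · rw [state_c_false]; exact a_mem
        · rw [state_c_true]; exact d_mem
      · cases x
        · rw [state_d_false]; exact one_mem _
        · rw [state_d_true]; exact b_mem
    | one => intro v _; rw [state_one]; exact one_mem _
    | mul g h _ _ ihg ihh =>
      intro v hv
      rw [state_mul]
      exact mul_mem (ihg v hv) (ihh _ ((g.length_act v).trans hv))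
    | inv g _ ih =>
      intro v hv
      rw [state_inv]
      exact inv_mem (ih _ ((g⁻¹.length_act v).trans hv))
  exact fun x => key [x] rfl

/-- `G` is self-similar. -/
theorem state_mem {g : TreeAut} (hg : g ∈ G) (v : List Bool) : g.state v ∈ G := by
  induction v generalizing g with
  | nil => rwa [state_nil]
  | cons x v ih =>
    rw [show x :: v = [x] ++ v from rfl, state_append]
    exact ih (state_letter_mem hg x)

/-- The decomposition `ψ_n : G → G ≀ Aut X^n`, `g ↦ (g|_v : v ∈ X^n) σ`, where `σ` is the image of
`g` in `Aut X^n`. -/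
def decomposition (n : ℕ) : G →* Wreath G n where
  toFun g := ⟨fun v => ⟨g.1.state v.1, state_mem g.2 v.1⟩, QuotientGroup.mk g.1⟩
  map_one' := by
    refine SemidirectProduct.ext (funext fun v => Subtype.ext ?_) rfl
    exact state_one v.1
  map_mul' g h := by
    refine SemidirectProduct.ext (funext fun v => Subtype.ext ?_) rfl
    exact state_mul g.1 h.1 v.1

/-! ### The subgroups `K` and `C`, the finite quotient, and the maps `π_n` -/

/-- The generator `a` as an element of `G`. -/
def aG : G := ⟨a, a_mem⟩
/-- The generator `b` as an element of `G`. -/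
def bG : G := ⟨b, b_mem⟩
/-- The generator `c` as an element of `G`. -/
def cG : G := ⟨c, c_mem⟩
/-- The generator `d` as an element of `G`. -/
def dG : G := ⟨d, d_mem⟩

/-- The commutator `[x, y] = x⁻¹ y⁻¹ x y`. -/
def comm {H : Type*} [Group H] (x y : H) : H := x⁻¹ * y⁻¹ * x * y

/-- The normal closure `K` of `[a,b], [b,c], [b,d], [c,d], bcd` in `G`. -/
def K : Subgroup G :=
  Subgroup.normalClosure {comm aG bG, comm bG cG, comm bG dG, comm cG dG, bG * cG * dG}

instance K_normal : K.Normal := Subgroup.normalClosure_normal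

/-- The subgroup `C` of `G` generated by `[K, G]` and `[a,b][b,c]`. -/
def C : Subgroup G :=
  Subgroup.closure ({g | ∃ k ∈ K, ∃ h : G, g = comm k h} ∪ {comm aG bG * comm bG cG})

theorem comm_mem_C {k : G} (hk : k ∈ K) (h : G) : comm k h ∈ C :=
  Subgroup.subset_closure (Or.inl ⟨k, hk, h, rfl⟩)

theorem C_le_K : C ≤ K := by
  refine (Subgroup.closure_le _).2 ?_
  rintro g (⟨k, hk, h, rfl⟩ | rfl)
  · have h1 := K_normal.conj_mem k hk h⁻¹
    rw [inv_inv] at h1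
    have h2 := mul_mem (inv_mem hk) h1
    rwa [← mul_assoc, ← mul_assoc] at h2
  · exact mul_mem (Subgroup.subset_normalClosure (by simp))
      (Subgroup.subset_normalClosure (by simp))

instance C_normal : C.Normal where
  conj_mem k hk g := by
    have h := mul_mem hk (comm_mem_C (C_le_K hk) g⁻¹)
    simpa [comm, mul_assoc] using h

/-- The group `Γ = G / C`. -/
abbrev Gam : Type := G ⧸ C

/-- The homomorphism `π_n : G → Γ ≀ Aut X^n`: the decomposition `ψ_n` followed by the quotient map
`G → G / C` on each coordinate. -/
def piMap (n : ℕ) : G →* Wreath Gam n :=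
  (Wreath.map (QuotientGroup.mk' C) n).comp (decomposition n)

end TwistedTwin

-- The kernel `M` of `f` is a nontrivial normal subgroup, because `G` is infinite, so it suffices
-- that every such `M` contains `ker π_n` for all large `n`.
--
-- `G` is self-replicating and level-transitive, and a copy of `K` below any vertex again lies in
-- `K` (`embed_mem_KT`). The double commutator trick then puts a copy of `[K,K]` below every vertex
-- of some level `n₀` inside `M` (`exists_level_commutator_mem`). An element of `ker π_n` fixes
-- level `n` and has its states there in `C`. Such states are improved on the way up the tree: a
-- copy of `C` one level down lies in `[K,G] ≤ C` (`embed_letter_CT`), and a copy of `[K,G]` three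
-- levels down lies in `[K,K]` (`embed_commutator_mem`), because the elements of `K` fixing the
-- vertex 111 have all of `G` as their states there (`G_le_proj_proj_proj`). Hence for `n ≥ n₀ + 4`
-- all states at level `n₀` lie in `[K,K]`, and the element is a product of members of `M`.
--
-- Subgroups are handled inside `Aut X*`, since a pair of elements of `G` need not lie in `G`.

namespace TwistedTwin

-- Pairs of states and automorphisms supported below a vertex

namespace TreeAut

theorem act_nil (g : TreeAut) : g.act [] = [] :=
  List.eq_nil_of_length_eq_zero (g.length_act [])

/-- The function underlying `pair`. -/
def pairFun (x y : TreeAut) : List Bool → List Bool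
  | [] => []
  | false :: w => false :: x.act w
  | true :: w => true :: y.act w

theorem pairFun_inv (x y : TreeAut) (w : List Bool) :
    pairFun x⁻¹ y⁻¹ (pairFun x y w) = w := by
  rcases w with _ | ⟨_ | _, w⟩ <;> simp [pairFun, act_inv_act]

/-- The automorphism fixing the first level, with states `x` at `0` and `y` at `1`. -/
def pair (x y : TreeAut) : TreeAut where
  toEquiv := ⟨pairFun x y, pairFun x⁻¹ y⁻¹, pairFun_inv x y, fun w => by
    simpa using pairFun_inv x⁻¹ y⁻¹ w⟩
  length_map w := by
    rcases w with _ | ⟨_ | _, w⟩ <;> simp [pairFun, length_act]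
  prefix_map u v := by
    rcases u with _ | ⟨_ | _, u⟩ <;> rcases v with _ | ⟨_ | _, v⟩ <;>
      simp [pairFun, List.cons_prefix_cons, act_prefix_act]

theorem pair_act_false (x y : TreeAut) (w : List Bool) :
    (pair x y).act (false :: w) = false :: x.act w := rfl

theorem pair_act_true (x y : TreeAut) (w : List Bool) :
    (pair x y).act (true :: w) = true :: y.act w := rfl

theorem ext_cons {g h : TreeAut} (h0 : ∀ w, g.act (false :: w) = h.act (false :: w))
    (h1 : ∀ w, g.act (true :: w) = h.act (true :: w)) : g = h :=
  ext_act fun w => by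
    rcases w with _ | ⟨_ | _, w⟩
    · rw [act_nil, act_nil]
    · exact h0 w
    · exact h1 w

theorem pair_mul (x y z w : TreeAut) : pair x y * pair z w = pair (x * z) (y * w) :=
  ext_cons (fun _ => rfl) (fun _ => rfl)

theorem pair_one : pair 1 1 = 1 := ext_cons (fun _ => rfl) (fun _ => rfl)

theorem pair_inv (x y : TreeAut) : (pair x y)⁻¹ = pair x⁻¹ y⁻¹ := rfl

theorem eq_pair {g : TreeAut} (h : ∀ x : Bool, g.act [x] = [x]) :
    g = pair (g.state [false]) (g.state [true]) :=
  ext_cons (fun w => by rw [pair_act_false]; simpa [h] using g.act_append_state [false] w)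
    (fun w => by rw [pair_act_true]; simpa [h] using g.act_append_state [true] w)

theorem pair_act_singleton (x y : TreeAut) (z : Bool) : (pair x y).act [z] = [z] := by
  cases z
  · rw [pair_act_false, act_nil]
  · rw [pair_act_true, act_nil]

theorem state_pair_false (x y : TreeAut) : (pair x y).state [false] = x :=
  state_eq_of fun w => by rw [pair_act_singleton]; rfl

theorem state_pair_true (x y : TreeAut) : (pair x y).state [true] = y :=
  state_eq_of fun w => by rw [pair_act_singleton]; rfl

/-- The embedding of `Aut X*` as the automorphisms supported below the vertex `v`. -/
def embed : List Bool → TreeAut →* TreeAut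
  | [] => MonoidHom.id _
  | false :: v =>
    { toFun := fun g => pair (embed v g) 1
      map_one' := by rw [map_one, pair_one]
      map_mul' := fun g h => by rw [map_mul, pair_mul, one_mul] }
  | true :: v =>
    { toFun := fun g => pair 1 (embed v g)
      map_one' := by rw [map_one, pair_one]
      map_mul' := fun g h => by rw [map_mul, pair_mul, one_mul] }

theorem embed_nil (g : TreeAut) : embed [] g = g := rfl

theorem embed_false (v : List Bool) (g : TreeAut) :
    embed (false :: v) g = pair (embed v g) 1 := rfl

theorem embed_true (v : List Bool) (g : TreeAut) :
    embed (true :: v) g = pair 1 (embed v g) := rfl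

theorem embed_append (u v : List Bool) (g : TreeAut) :
    embed (u ++ v) g = embed u (embed v g) := by
  induction u with
  | nil => rfl
  | cons x u ih => cases x <;> simp [embed_false, embed_true, ih]

theorem embed_act_append (v : List Bool) (g : TreeAut) (w : List Bool) :
    (embed v g).act (v ++ w) = v ++ g.act w := by
  induction v with
  | nil => rfl
  | cons x v ih =>
    cases x <;> simp [embed_false, embed_true, pair_act_false, pair_act_true, ih]

theorem embed_act_of_not_prefix {v w : List Bool} (h : ¬ v <+: w) (g : TreeAut) :
    (embed v g).act w = w := by
  induction v generalizing w with
  | nil => exact absurd (List.nil_prefix) h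
  | cons x v ih =>
    rcases w with _ | ⟨y, w⟩
    · exact act_nil _
    · cases x <;> cases y <;>
        simp [List.cons_prefix_cons, embed_false, embed_true, pair_act_false, pair_act_true,
          act_one] at h ⊢ <;> exact ih h

theorem embed_mul_eq (v : List Bool) (g h : TreeAut) :
    embed v g * h = h * embed (h.act v) ((h.state v)⁻¹ * g * h.state v) := by
  refine ext_act fun w => ?_
  rw [act_mul, act_mul]
  by_cases hw : v <+: w
  · obtain ⟨u, rfl⟩ := hw
    rw [embed_act_append, act_append_state, act_append_state, embed_act_append, act_mul, act_mul,
      act_inv_act]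
  · rw [embed_act_of_not_prefix hw, embed_act_of_not_prefix]
    rwa [act_prefix_act]

theorem conj_embed (v : List Bool) (g h : TreeAut) :
    h⁻¹ * embed v g * h = embed (h.act v) ((h.state v)⁻¹ * g * h.state v) := by
  rw [mul_assoc, embed_mul_eq, inv_mul_cancel_left]

/-- The second factor fixes `u` and has trivial state there, so conjugation by it changes nothing
below `u`. -/
theorem commute_embed {u v : List Bool} (hl : u.length = v.length) (hne : u ≠ v)
    (g h : TreeAut) : Commute (embed u g) (embed v h) := by
  have hfix : (embed v h).act u = u :=
    embed_act_of_not_prefix (fun hp => hne (hp.eq_of_length hl.symm).symm) h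
  have hst : (embed v h).state u = 1 := state_eq_of fun w => by
    rw [hfix, act_one, embed_act_of_not_prefix]
    exact fun hp => hne (List.prefix_of_prefix_length_le (List.prefix_append u w) hp hl.le
      |>.eq_of_length hl)
  have := embed_mul_eq u g (embed v h)
  rw [hfix, hst, inv_one, one_mul, mul_one] at this
  exact this

/-- An element of `Stab(n)` is the product of the copies of its states at level `n`. The induction
varies `S`, which is pulled back along `embed [x]`. -/
theorem mem_of_embed_state_mem (S : Subgroup TreeAut) (n : ℕ) (g : TreeAut)
    (hg : g ∈ levelStab n) (h : ∀ v : List Bool, v.length = n → embed v (g.state v) ∈ S) :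
    g ∈ S := by
  induction n generalizing S g with
  | zero => simpa [state_nil, embed_nil] using h [] rfl
  | succ n ih =>
    have hfix (x : Bool) : g.act [x] = [x] := by
      have h1 := hg (x :: List.replicate n false) (by simp)
      have h2 := (g.act_prefix_act [x] (x :: List.replicate n false)).2 ⟨_, rfl⟩
      rw [h1] at h2
      exact (List.prefix_of_prefix_length_le h2 ⟨_, rfl⟩ (g.length_act [x]).le).eq_of_length
        (g.length_act [x])
    have hstep (x : Bool) : embed [x] (g.state [x]) ∈ S := by
      refine ih (S.comap (embed [x])) (g.state [x]) (fun w hw => ?_) (fun v hv => ?_)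
      · have h1 := g.act_append_state [x] w
        rw [hg _ (by simp [hw]), hfix] at h1
        exact (List.append_cancel_left h1).symm
      · rw [Subgroup.mem_comap, ← embed_append, ← state_append]
        exact h _ (by simp [hv])
    rw [eq_pair hfix]
    have := mul_mem (hstep false) (hstep true)
    rwa [embed_false, embed_true, pair_mul, one_mul, mul_one] at this

end TreeAut

open TreeAut
open scoped commutatorElement

/-! ### Relations among the generators -/

theorem a_mul_a : a * a = 1 := ext_act aFun_aFun
theorem b_mul_b : b * b = 1 := ext_act fun w => (bcd_invol w).1
theorem c_mul_c : c * c = 1 := ext_act fun w => (bcd_invol w).2.1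
theorem d_mul_d : d * d = 1 := ext_act fun w => (bcd_invol w).2.2

theorem a_inv : a⁻¹ = a := inv_eq_of_mul_eq_one_right a_mul_a
theorem b_inv : b⁻¹ = b := inv_eq_of_mul_eq_one_right b_mul_b
theorem c_inv : c⁻¹ = c := inv_eq_of_mul_eq_one_right c_mul_c
theorem d_inv : d⁻¹ = d := inv_eq_of_mul_eq_one_right d_mul_d

theorem a_mul_a_mul (x : TreeAut) : a * (a * x) = x := by rw [← mul_assoc, a_mul_a, one_mul]
theorem b_mul_b_mul (x : TreeAut) : b * (b * x) = x := by rw [← mul_assoc, b_mul_b, one_mul]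
theorem c_mul_c_mul (x : TreeAut) : c * (c * x) = x := by rw [← mul_assoc, c_mul_c, one_mul]
theorem d_mul_d_mul (x : TreeAut) : d * (d * x) = x := by rw [← mul_assoc, d_mul_d, one_mul]

theorem b_eq : b = pair c a := ext_cons
  (fun w => show bFun _ = _ by rw [bFun]; rfl) (fun w => show bFun _ = _ by rw [bFun]; rfl)
theorem c_eq : c = pair a d := ext_cons
  (fun w => show cFun _ = _ by rw [cFun]; rfl) (fun w => show cFun _ = _ by rw [cFun]; rfl)
theorem d_eq : d = pair 1 b := ext_cons
  (fun w => show dFun _ = _ by rw [dFun]; rfl) (fun w => show dFun _ = _ by rw [dFun]; rfl)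

theorem a_pair_a (x y : TreeAut) : a * pair x y * a = pair y x :=
  ext_cons (fun _ => rfl) (fun _ => rfl)

theorem a_b_a : a * b * a = pair a c := by rw [b_eq, a_pair_a]
theorem a_c_a : a * c * a = pair d a := by rw [c_eq, a_pair_a]
theorem a_d_a : a * d * a = pair b 1 := by rw [d_eq, a_pair_a]

/-! ### Self-replication and level transitivity -/

/-- Each generator occurs as a second coordinate: `b = (c,a)`, `d = (1,b)`, `aba = (a,c)`, `c =
(a,d)`. -/
theorem exists_pair_mem {g : TreeAut} (hg : g ∈ G) : ∃ x, pair x g ∈ G := by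
  induction hg using Subgroup.closure_induction with
  | mem g hg =>
    rcases hg with rfl | rfl | rfl | rfl
    · exact ⟨c, b_eq ▸ b_mem⟩
    · exact ⟨1, d_eq ▸ d_mem⟩
    · exact ⟨a, a_b_a ▸ mul_mem (mul_mem a_mem b_mem) a_mem⟩
    · exact ⟨a, c_eq ▸ c_mem⟩
  | one => exact ⟨1, by rw [pair_one]; exact one_mem _⟩
  | mul g h _ _ ihg ihh =>
    obtain ⟨x, hx⟩ := ihg
    obtain ⟨y, hy⟩ := ihh
    exact ⟨x * y, pair_mul x g y h ▸ mul_mem hx hy⟩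
  | inv g _ ih =>
    obtain ⟨x, hx⟩ := ih
    exact ⟨x⁻¹, pair_inv x g ▸ inv_mem hx⟩

theorem exists_letter_lift {g : TreeAut} (hg : g ∈ G) (x : Bool) :
    ∃ h ∈ G, h.act [x] = [x] ∧ h.state [x] = g := by
  obtain ⟨y, hy⟩ := exists_pair_mem hg
  cases x
  · exact ⟨pair g y, a_pair_a y g ▸ mul_mem (mul_mem a_mem hy) a_mem,
      pair_act_singleton g y _, state_pair_false g y⟩
  · exact ⟨pair y g, hy, pair_act_singleton y g _, state_pair_true y g⟩

theorem exists_lift {g : TreeAut} (hg : g ∈ G) (v : List Bool) :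
    ∃ h ∈ G, h.act v = v ∧ h.state v = g := by
  induction v with
  | nil => exact ⟨g, hg, act_nil g, state_nil g⟩
  | cons x v ih =>
    obtain ⟨h, hh, h1, h2⟩ := ih
    obtain ⟨k, hk, h3, h4⟩ := exists_letter_lift hh x
    refine ⟨k, hk, ?_, ?_⟩
    · rw [show x :: v = [x] ++ v from rfl, act_append_state, h3, h4, h1]
    · rw [show x :: v = [x] ++ v from rfl, state_append, h4, h2]

theorem exists_act_eq_replicate (v : List Bool) :
    ∃ h ∈ G, h.act v = List.replicate v.length true := by
  induction v with
  | nil => exact ⟨1, one_mem _, rfl⟩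
  | cons x v ih =>
    obtain ⟨h, hh, h1⟩ := ih
    obtain ⟨k, hk, h3, h4⟩ := exists_letter_lift hh x
    have hx : k.act (x :: v) = x :: List.replicate v.length true := by
      rw [show x :: v = [x] ++ v from rfl, act_append_state, h3, h4, h1]; rfl
    cases x
    · exact ⟨k * a, mul_mem hk a_mem, by rw [act_mul, hx]; rfl⟩
    · exact ⟨k, hk, hx⟩

theorem level_transitive {u v : List Bool} (h : u.length = v.length) :
    ∃ g ∈ G, g.act u = v := by
  obtain ⟨g, hg, h1⟩ := exists_act_eq_replicate u
  obtain ⟨k, hk, h2⟩ := exists_act_eq_replicate v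
  exact ⟨g * k⁻¹, mul_mem hg (inv_mem hk), by rw [act_mul, h1, h, ← h2, act_inv_act]⟩

/-- Choosing for each `g` a lift that fixes the vertex 1 with state `g` gives an injection of `G`
into itself. It misses `a`, which moves 1. -/
theorem infinite_G : Infinite G := by
  by_contra hfin
  rw [not_infinite_iff_finite] at hfin
  choose s hs hs1 hs2 using fun g : G => exists_letter_lift g.2 true
  have hinj : Function.Injective (fun g : G => (⟨s g, hs g⟩ : G)) := fun g h hgh =>
    Subtype.ext <| by rw [← hs2 g, ← hs2 h, Subtype.mk.inj hgh]
  obtain ⟨g, hg⟩ := Finite.injective_iff_surjective.1 hinj aG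
  have h1 := hs1 g
  rw [show s g = a from congrArg Subtype.val hg] at h1
  exact absurd h1 (by decide)

/-! ### Subgroups normalized by `G` -/

/-- `S` is normalized by `G`. -/
def Invariant (S : Subgroup TreeAut) : Prop :=
  ∀ g ∈ G, ∀ s ∈ S, g⁻¹ * s * g ∈ S

theorem Invariant.conj {S : Subgroup TreeAut} (hS : Invariant S) {g s : TreeAut} (hg : g ∈ G)
    (hs : s ∈ S) : g * s * g⁻¹ ∈ S := by
  simpa using hS g⁻¹ (inv_mem hg) s hs

theorem invariant_G : Invariant G := fun _ hg _ hs => mul_mem (mul_mem (inv_mem hg) hs) hg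

theorem Invariant.commutator {S T : Subgroup TreeAut} (hS : Invariant S) (hT : Invariant T) :
    Invariant ⁅S, T⁆ := by
  intro g hg s hs
  have hle : ⁅S, T⁆ ≤ (⁅S, T⁆).comap (MulAut.conj g⁻¹).toMonoidHom := by
    refine Subgroup.commutator_le.2 fun x hx y hy => ?_
    rw [Subgroup.mem_comap, map_commutatorElement]
    refine Subgroup.commutator_mem_commutator ?_ ?_
    · simpa using hS g hg x hx
    · simpa using hT g hg y hy
  simpa using hle hs

theorem invariant_map (N : Subgroup G) [hN : N.Normal] : Invariant (N.map G.subtype) := by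
  rintro g hg _ ⟨s, hs, rfl⟩
  have := hN.conj_mem s hs ⟨g, hg⟩⁻¹
  exact ⟨_, this, by simp⟩

theorem Invariant.comap_normal {S : Subgroup TreeAut} (hS : Invariant S) :
    (S.comap G.subtype).Normal :=
  ⟨fun s hs g => by
    rw [Subgroup.mem_comap] at hs ⊢
    simpa using hS.conj g.2 hs⟩

theorem Invariant.comap_embed {S : Subgroup TreeAut} (hS : Invariant S) (v : List Bool) :
    Invariant (S.comap (embed v)) := by
  intro g hg s hs
  obtain ⟨h, hh, h1, h2⟩ := exists_lift hg v
  have := hS h hh _ hs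
  rwa [conj_embed, h1, h2] at this

/-- Conjugation by an element of `G` moving `u` to `v` carries one copy of `T` to the other; its
state at `u` is absorbed by the invariance of `T`. -/
theorem Invariant.embed_mem_of_length_eq {S T : Subgroup TreeAut} (hS : Invariant S)
    (hT : Invariant T) {u v : List Bool} (huv : u.length = v.length)
    (h : ∀ t ∈ T, embed u t ∈ S) : ∀ t ∈ T, embed v t ∈ S := by
  intro t ht
  obtain ⟨g, hg, rfl⟩ := level_transitive huv
  have := hS g hg _ (h _ (hT.conj (state_mem hg u) ht))
  rw [conj_embed] at this
  simpa [mul_assoc] using this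

/-! ### The subgroup `K` -/

/-- `K` as a subgroup of `Aut X*`. -/
def KT : Subgroup TreeAut := K.map G.subtype

theorem invariant_KT : Invariant KT := invariant_map K

theorem KT_le_G : KT ≤ G := by
  rintro _ ⟨k, _, rfl⟩
  exact k.2

theorem KT_le {S : Subgroup TreeAut} (hS : Invariant S) (h1 : comm a b ∈ S) (h2 : comm b c ∈ S)
    (h3 : comm b d ∈ S) (h4 : comm c d ∈ S) (h5 : b * c * d ∈ S) : KT ≤ S := by
  refine Subgroup.map_le_iff_le_comap.2 ?_
  have := hS.comap_normal
  refine Subgroup.normalClosure_le_normal ?_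
  rintro _ (rfl | rfl | rfl | rfl | rfl)
  exacts [h1, h2, h3, h4, h5]

theorem comm_a_b_mem : comm a b ∈ KT :=
  ⟨comm aG bG, Subgroup.subset_normalClosure (by simp), rfl⟩
theorem comm_b_c_mem : comm b c ∈ KT :=
  ⟨comm bG cG, Subgroup.subset_normalClosure (by simp), rfl⟩
theorem comm_b_d_mem : comm b d ∈ KT :=
  ⟨comm bG dG, Subgroup.subset_normalClosure (by simp), rfl⟩
theorem comm_c_d_mem : comm c d ∈ KT :=
  ⟨comm cG dG, Subgroup.subset_normalClosure (by simp), rfl⟩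
theorem b_c_d_mem : b * c * d ∈ KT :=
  ⟨bG * cG * dG, Subgroup.subset_normalClosure (by simp), rfl⟩

theorem pair_one_comm_a_b : pair 1 (comm a b) = comm b d := by
  simp only [comm, a_inv, b_inv, d_inv]
  rw [d_eq, b_eq, pair_mul, pair_mul, pair_mul, ← b_eq]
  simp [c_mul_c]

theorem pair_one_comm_b_d : pair 1 (comm b d) = (comm c d)⁻¹ := by
  simp only [comm, c_inv, b_inv, d_inv, mul_inv_rev]
  rw [d_eq, c_eq, pair_mul, pair_mul, pair_mul, ← d_eq]
  simp [a_mul_a, mul_assoc]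

theorem pair_one_comm_b_c : pair 1 (comm b c) = d * (a * b * a) * d * (a * b * a) := by
  rw [a_b_a, d_eq, pair_mul, pair_mul, pair_mul]
  simp [comm, b_inv, c_inv, a_mul_a]

theorem pair_one_comm_c_d : pair 1 (comm c d) = (a * b * a) * c * (a * b * a) * c := by
  rw [a_b_a]
  conv_rhs => rw [c_eq]
  rw [pair_mul, pair_mul, pair_mul, ← c_eq]
  simp [comm, c_inv, d_inv, a_mul_a]

theorem pair_one_b_c_d : pair 1 (b * c * d) = d * (a * b * a) * c := by
  rw [a_b_a]
  conv_rhs => rw [d_eq, c_eq]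
  rw [pair_mul, pair_mul, ← c_eq]
  simp [a_mul_a]

theorem pair_one_comm_b_c_mem : pair 1 (comm b c) ∈ KT := by
  have h1 : d * comm a b * d⁻¹ ∈ KT := invariant_KT.conj d_mem comm_a_b_mem
  have h2 : d * b * d * b ∈ KT := by
    have := inv_mem comm_b_d_mem
    simpa [comm, b_inv, d_inv, mul_assoc] using this
  have h3 : b * (a * b * a) ∈ KT := by
    have := inv_mem comm_a_b_mem
    simpa [comm, b_inv, a_inv, mul_assoc] using this
  -- `d·aba·d·aba` is the product of a conjugate of `[a,b]`, `[b,d]⁻¹` and `[a,b]⁻¹`.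
  have := mul_mem (mul_mem h1 h2) h3
  rw [pair_one_comm_b_c]
  simpa [comm, a_inv, b_inv, d_inv, mul_assoc, b_mul_b_mul, d_mul_d_mul] using this

theorem pair_one_comm_c_d_mem : pair 1 (comm c d) ∈ KT := by
  have h1 : comm a b ∈ KT := comm_a_b_mem
  have h2 : (b * c) * (comm a b) * (b * c)⁻¹ ∈ KT :=
    invariant_KT.conj (mul_mem b_mem c_mem) comm_a_b_mem
  have := mul_mem (mul_mem h1 h2) comm_b_c_mem
  rw [pair_one_comm_c_d]
  simpa [comm, a_inv, b_inv, c_inv, mul_assoc, b_mul_b_mul, c_mul_c_mul] using this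

theorem pair_one_b_c_d_mem : pair 1 (b * c * d) ∈ KT := by
  have h1 : d * comm a b * d⁻¹ ∈ KT := invariant_KT.conj d_mem comm_a_b_mem
  have h2 : d * (b * c * d) * d⁻¹ ∈ KT := invariant_KT.conj d_mem b_c_d_mem
  have := mul_mem h1 h2
  rw [pair_one_b_c_d]
  simpa [comm, a_inv, b_inv, d_inv, d_mul_d, mul_assoc, b_mul_b_mul, d_mul_d_mul] using this

/-- `K` is a branching subgroup. By invariance and transitivity, only the generators of `K` placed
below the vertex 1 need checking. -/
theorem embed_mem_KT (v : List Bool) : ∀ k ∈ KT, embed v k ∈ KT := by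
  have htrue : KT ≤ KT.comap (embed [true]) :=
    KT_le (invariant_KT.comap_embed _)
      (show pair 1 _ ∈ KT from pair_one_comm_a_b ▸ comm_b_d_mem)
      pair_one_comm_b_c_mem
      (show pair 1 _ ∈ KT from pair_one_comm_b_d ▸ inv_mem comm_c_d_mem)
      pair_one_comm_c_d_mem pair_one_b_c_d_mem
  induction v with
  | nil => exact fun k hk => hk
  | cons x v ih =>
    intro k hk
    rw [show x :: v = [x] ++ v from rfl, embed_append]
    exact invariant_KT.embed_mem_of_length_eq invariant_KT (u := [true]) (v := [x]) rfl
      (fun t ht => htrue ht) _ (ih k hk)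

/-! ### The subgroup `C` -/

/-- `C` as a subgroup of `Aut X*`. -/
def CT : Subgroup TreeAut := C.map G.subtype

theorem invariant_CT : Invariant CT := invariant_map C

theorem invariant_commutator_KT_G : Invariant ⁅KT, G⁆ := invariant_KT.commutator invariant_G

theorem commutator_KT_G_le_CT : ⁅KT, G⁆ ≤ CT := by
  refine Subgroup.commutator_le.2 ?_
  rintro _ ⟨k, hk, rfl⟩ g hg
  -- The inverses translate between the conventions `x⁻¹y⁻¹xy` and `xyx⁻¹y⁻¹`.
  exact ⟨_, comm_mem_C (inv_mem hk) ⟨g, hg⟩⁻¹, by simp [comm, commutatorElement_def]⟩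

theorem CT_le {S : Subgroup TreeAut} (h : ∀ k ∈ KT, ∀ g ∈ G, ⁅k, g⁆ ∈ S)
    (ht : comm a b * comm b c ∈ S) : CT ≤ S := by
  refine Subgroup.map_le_iff_le_comap.2 ((Subgroup.closure_le _).2 ?_)
  rintro _ (⟨k, hk, g, rfl⟩ | rfl)
  · change comm (k : TreeAut) (g : TreeAut) ∈ S
    simpa [comm, commutatorElement_def] using
      h (k : TreeAut)⁻¹ (inv_mem ⟨k, hk, rfl⟩) (g : TreeAut)⁻¹ (inv_mem g.2)
  · exact ht

/-- The element equals `b⁅d, [a,b]⁻¹⁆b⁻¹`. So one level down, the extra generator of `C` already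
falls into `[K,G]`. -/
theorem pair_one_comm_mul_comm_mem : pair 1 (comm a b * comm b c) ∈ ⁅KT, G⁆ := by
  have h1 : ⁅d, (comm a b)⁻¹⁆ ∈ ⁅KT, G⁆ := by
    rw [Subgroup.commutator_comm]
    exact Subgroup.commutator_mem_commutator d_mem (inv_mem comm_a_b_mem)
  have h2 := invariant_commutator_KT_G.conj b_mem h1
  have h3 : pair 1 (comm a b * comm b c) = pair 1 (comm a b) * pair 1 (comm b c) := by
    rw [pair_mul, one_mul]
  rw [h3, pair_one_comm_a_b, pair_one_comm_b_c]
  simpa [comm, commutatorElement_def, a_inv, b_inv, d_inv, mul_assoc, b_mul_b, b_mul_b_mul,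
    d_mul_d_mul] using h2

/-- For the generators `⁅k,g⁆`, lift `g` to `(y,g) ∈ G`: then `⁅(1,k),(y,g)⁆ = (1,⁅k,g⁆)`, with
`(1,k) ∈ K`. -/
theorem embed_letter_CT (x : Bool) : ∀ g ∈ CT, embed [x] g ∈ ⁅KT, G⁆ := by
  refine invariant_commutator_KT_G.embed_mem_of_length_eq invariant_CT (u := [true]) rfl
    fun t ht => ?_
  refine CT_le (S := ⁅KT, G⁆.comap (embed [true])) (fun k hk g hg => ?_)
    pair_one_comm_mul_comm_mem ht
  obtain ⟨y, hy⟩ := exists_pair_mem hg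
  have h1 := Subgroup.commutator_mem_commutator (embed_mem_KT [true] k hk) hy
  rw [embed_true, embed_nil] at h1
  rw [Subgroup.mem_comap, embed_true, embed_nil]
  simpa [commutatorElement_def, pair_mul, pair_inv] using h1

theorem mem_CT_of_state_mem (m : ℕ) (g : TreeAut) (hg : g ∈ levelStab m)
    (h : ∀ v : List Bool, v.length = m → g.state v ∈ CT) : g ∈ CT := by
  refine mem_of_embed_state_mem CT m g hg fun v hv => ?_
  have key (v : List Bool) : ∀ t ∈ CT, embed v t ∈ CT := by
    induction v with
    | nil => exact fun t ht => ht
    | cons x v ih =>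
      intro t ht
      rw [show x :: v = [x] ++ v from rfl, embed_append]
      exact commutator_KT_G_le_CT (embed_letter_CT x _ (ih t ht))
  exact key v _ (h v hv)

theorem mem_levelStab_state {m n : ℕ} {g : TreeAut} (hg : g ∈ levelStab (m + n)) {v : List Bool}
    (hv : v.length = m) : g.state v ∈ levelStab n := by
  intro w hw
  have h1 := g.act_append_state v w
  rw [hg _ (by simp [hv, hw])] at h1
  exact (List.append_inj h1 (g.length_act v).symm).2.symm

theorem mem_commutator_of_state_mem (m : ℕ) (g : TreeAut) (hg : g ∈ levelStab (1 + m))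
    (h : ∀ v : List Bool, v.length = 1 + m → g.state v ∈ CT) (h1 : g ∈ levelStab 1) :
    g ∈ ⁅KT, G⁆ := by
  refine mem_of_embed_state_mem _ 1 g h1 fun v hv => ?_
  have h2 : g.state v ∈ CT := mem_CT_of_state_mem m _ (mem_levelStab_state hg hv) fun w hw => by
    rw [← state_append]
    exact h _ (by simp [hv, hw])
  obtain ⟨x, rfl⟩ := List.length_eq_one_iff.1 hv
  exact embed_letter_CT x _ h2

/-! ### Projections of `K` -/

/-- The states at `1` of the elements of `S` that fix the first level. -/
def proj (S : Subgroup TreeAut) : Subgroup TreeAut where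
  carrier := {g | ∃ x, pair x g ∈ S}
  one_mem' := ⟨1, by rw [pair_one]; exact one_mem _⟩
  mul_mem' := by
    rintro g h ⟨x, hx⟩ ⟨y, hy⟩
    exact ⟨x * y, pair_mul x g y h ▸ mul_mem hx hy⟩
  inv_mem' := by
    rintro g ⟨x, hx⟩
    exact ⟨x⁻¹, pair_inv x g ▸ inv_mem hx⟩

theorem mem_proj {S : Subgroup TreeAut} {g : TreeAut} : g ∈ proj S ↔ ∃ x, pair x g ∈ S := Iff.rfl

theorem Invariant.proj {S : Subgroup TreeAut} (hS : Invariant S) : Invariant (proj S) := by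
  intro g hg s hs
  obtain ⟨x, hx⟩ := mem_proj.1 hs
  obtain ⟨y, hy⟩ := exists_pair_mem hg
  refine mem_proj.2 ⟨y⁻¹ * x * y, ?_⟩
  simpa [pair_inv, pair_mul] using hS _ hy _ hx

theorem c_a_mem_proj : c * a ∈ proj KT := by
  refine mem_proj.2 ⟨a * c, ?_⟩
  have : pair (a * c) (c * a) = comm a b := by
    simp only [comm, a_inv, b_inv]
    rw [a_b_a, b_eq, pair_mul]
  exact this ▸ comm_a_b_mem

theorem a_d_b_mem_proj : a * d * b ∈ proj KT := by
  refine mem_proj.2 ⟨c * a, ?_⟩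
  have : pair (c * a) (a * d * b) = b * c * d := by
    have h : b * c * d = pair c a * pair a d * pair 1 b := by rw [← b_eq, ← c_eq, ← d_eq]
    rw [h, pair_mul, pair_mul, mul_one]
  exact this ▸ b_c_d_mem

theorem comm_a_b_mem_proj : comm a b ∈ proj KT :=
  mem_proj.2 ⟨1, pair_one_comm_a_b ▸ comm_b_d_mem⟩

theorem c_a_mem_proj_proj : c * a ∈ proj (proj KT) := by
  refine mem_proj.2 ⟨a * c, ?_⟩
  have : pair (a * c) (c * a) = comm a b := by
    simp only [comm, a_inv, b_inv]
    rw [a_b_a, b_eq, pair_mul]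
  exact this ▸ comm_a_b_mem_proj

/-- `adb` and `ca` both swap the first level, so `adb·(ca)⁻¹` fixes it and can be projected once
more, to `cd` and, after conjugation by `a`, to `b`. -/
theorem a_d_b_a_c_mem_proj : a * d * b * (a * c) ∈ proj KT := by
  have := mul_mem a_d_b_mem_proj (inv_mem c_a_mem_proj)
  simpa [a_inv, c_inv] using this

theorem a_d_b_a_c_eq : a * d * b * (a * c) = pair b (c * d) := by
  have : a * d * b * (a * c) = (a * d * a) * (a * b * a) * c := by
    simp [mul_assoc, a_mul_a_mul]
  rw [this, a_d_a, a_b_a, pair_mul]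
  conv_lhs => rw [c_eq]
  rw [pair_mul, ← c_eq, mul_assoc, a_mul_a, mul_one, one_mul]

theorem c_d_mem_proj_proj : c * d ∈ proj (proj KT) :=
  mem_proj.2 ⟨b, a_d_b_a_c_eq ▸ a_d_b_a_c_mem_proj⟩

theorem b_mem_proj_proj : b ∈ proj (proj KT) := by
  refine mem_proj.2 ⟨c * d, ?_⟩
  have := invariant_KT.proj a a_mem _ a_d_b_a_c_mem_proj
  rwa [a_d_b_a_c_eq, a_inv, a_pair_a] at this

/-- The second projection contains `b = (c,a)`, `aba = (a,c)`, `cd = (a,db)` and `acad = (d,ab)`;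
the second coordinates generate `G`. -/
theorem G_le_proj_proj_proj : G ≤ proj (proj (proj KT)) := by
  have hinv := invariant_KT.proj.proj
  have ha : a ∈ proj (proj (proj KT)) := mem_proj.2 ⟨c, b_eq ▸ b_mem_proj_proj⟩
  have hc : c ∈ proj (proj (proj KT)) := by
    refine mem_proj.2 ⟨a, ?_⟩
    have := hinv a a_mem _ b_mem_proj_proj
    rwa [a_inv, a_b_a] at this
  have hdb : d * b ∈ proj (proj (proj KT)) := by
    refine mem_proj.2 ⟨a, ?_⟩
    have h1 : pair a (d * b) = c * d := by
      conv_rhs => rw [c_eq, d_eq]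
      rw [pair_mul, ← d_eq, mul_one]
    exact h1 ▸ c_d_mem_proj_proj
  have hab : a * b ∈ proj (proj (proj KT)) := by
    refine mem_proj.2 ⟨d, ?_⟩
    have h1 : pair d (a * b) = (c * a)⁻¹ * ((c * a)⁻¹ * (c * d)) := by
      have h2 : (c * a)⁻¹ * ((c * a)⁻¹ * (c * d)) = a * c * a * d := by
        simp [a_inv, c_inv, mul_assoc, c_mul_c_mul]
      rw [h2, a_c_a]
      conv_rhs => rw [d_eq]
      rw [pair_mul, ← d_eq, mul_one]
    have h3 := inv_mem c_a_mem_proj_proj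
    exact h1 ▸ mul_mem h3 (mul_mem h3 c_d_mem_proj_proj)
  have hb : b ∈ proj (proj (proj KT)) := by
    simpa using mul_mem (inv_mem ha) hab
  have hd : d ∈ proj (proj (proj KT)) := by
    simpa using mul_mem hdb (inv_mem hb)
  refine (Subgroup.closure_le _).2 ?_
  rintro g (rfl | rfl | rfl | rfl) <;> assumption

/-- Commute a copy of `k` at 111 with an element of `K` fixing 111 with state `g` there: the other
coordinates `x`, `y`, `z` cancel, leaving a copy of `⁅k,g⁆`. -/
theorem embed_commutator_mem (v : List Bool) (hv : v.length = 3) :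
    ∀ t ∈ ⁅KT, G⁆, embed v t ∈ ⁅KT, KT⁆ := by
  refine (invariant_KT.commutator invariant_KT).embed_mem_of_length_eq
    invariant_commutator_KT_G (u := [true, true, true]) hv.symm fun t ht => ?_
  refine (Subgroup.commutator_le (H₃ := ⁅KT, KT⁆.comap (embed [true, true, true]))).2
    (fun k hk g hg => ?_) ht
  obtain ⟨x, h⟩ := mem_proj.1 (G_le_proj_proj_proj hg)
  obtain ⟨y, h⟩ := mem_proj.1 h
  obtain ⟨z, h⟩ := mem_proj.1 h
  have h1 := Subgroup.commutator_mem_commutator (embed_mem_KT [true, true, true] k hk) h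
  simp only [embed_true, embed_nil] at h1
  rw [Subgroup.mem_comap]
  simp only [embed_true, embed_nil]
  simpa [commutatorElement_def, pair_mul, pair_inv] using h1

theorem levelStab_antitone {m n : ℕ} (h : m ≤ n) : levelStab n ≤ levelStab m := by
  intro g hg w hw
  have h1 := g.act_append_state w (List.replicate (n - m) false)
  rw [hg _ (by simp [hw, h])] at h1
  exact (List.append_inj h1 (g.length_act w).symm).1.symm

/-- Of the four extra levels, one takes `C` into `[K,G]` and three take `[K,G]` into `[K,K]`. -/
theorem mem_commutator_KT_KT (m : ℕ) (g : TreeAut) (hg : g ∈ levelStab (4 + m))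
    (h : ∀ v : List Bool, v.length = 4 + m → g.state v ∈ CT) : g ∈ ⁅KT, KT⁆ := by
  refine mem_of_embed_state_mem _ 3 g (levelStab_antitone (by omega) hg) fun v hv => ?_
  refine embed_commutator_mem v hv _ ?_
  have h1 : g.state v ∈ levelStab (1 + m) :=
    mem_levelStab_state (m := 3) (by rwa [← add_assoc]) hv
  refine mem_commutator_of_state_mem m _ h1 (fun w hw => ?_) (levelStab_antitone (by omega) h1)
  rw [← state_append]
  exact h _ (by rw [List.length_append]; omega)

/-! ### Normal subgroups of finite index -/

/-- Let `g⁻¹` move `v`, and let `X`, `Y` be copies of elements of `K` below `v`. Then `⁅X,g⁆ =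
X·(gX⁻¹g⁻¹)`, whose second factor lives below another vertex of the same level and commutes with
`Y`. So `⁅X,Y⁆ = ⁅⁅X,g⁆,Y⁆ ∈ S`. -/
theorem exists_level_commutator_mem {S : Subgroup TreeAut} (hS : Invariant S) {g : TreeAut}
    (hg : g ∈ S) (hne : g ≠ 1) :
    ∃ n : ℕ, ∀ v : List Bool, v.length = n → ∀ k ∈ ⁅KT, KT⁆, embed v k ∈ S := by
  obtain ⟨v, hv⟩ : ∃ v, g⁻¹.act v ≠ v := by
    by_contra! h
    exact hne (inv_eq_one.1 (ext_act h))
  refine ⟨v.length, fun u hu => hS.embed_mem_of_length_eq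
    (invariant_KT.commutator invariant_KT) hu.symm fun t ht => ?_⟩
  refine (Subgroup.commutator_le (H₃ := S.comap (embed v))).2 (fun x hx y hy => ?_) ht
  rw [Subgroup.mem_comap, map_commutatorElement]
  have hX : embed v x ∈ G := KT_le_G (embed_mem_KT v x hx)
  have hY : embed v y ∈ G := KT_le_G (embed_mem_KT v y hy)
  have hz := conj_embed v x⁻¹ g⁻¹
  rw [inv_inv] at hz
  have hcomm := commute_embed ((g⁻¹).length_act v) hv
    ((g⁻¹.state v)⁻¹ * x⁻¹ * g⁻¹.state v) y
  rw [← hz, map_inv] at hcomm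
  have h1 : embed v x * g * (embed v x)⁻¹ * g⁻¹ ∈ S := mul_mem (hS.conj hX hg) (inv_mem hg)
  have h2 := mul_mem h1 (hS.conj hY (inv_mem h1))
  have h3 : ⁅embed v x, embed v y⁆ = embed v x * g * (embed v x)⁻¹ * g⁻¹ *
      (embed v y * (embed v x * g * (embed v x)⁻¹ * g⁻¹)⁻¹ * (embed v y)⁻¹) := by
    have h4 := hcomm.eq
    generalize embed v x = X at *
    generalize embed v y = Y at *
    rw [commutatorElement_def]
    have h5 : Y * (g * X⁻¹ * g⁻¹)⁻¹ = (g * X⁻¹ * g⁻¹)⁻¹ * Y := by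
      rw [eq_inv_mul_iff_mul_eq, ← mul_assoc, h4]; group
    calc X * Y * X⁻¹ * Y⁻¹
        = X * (g * X⁻¹ * g⁻¹) * ((g * X⁻¹ * g⁻¹)⁻¹ * Y) * X⁻¹ * Y⁻¹ := by group
      _ = X * (g * X⁻¹ * g⁻¹) * (Y * (g * X⁻¹ * g⁻¹)⁻¹) * X⁻¹ * Y⁻¹ := by rw [h5]
      _ = _ := by group
  rw [h3]
  exact h2

theorem piMap_eq_one {n : ℕ} {g : G} (h : piMap n g = 1) :
    (g : TreeAut) ∈ levelStab n ∧
      ∀ v : List Bool, v.length = n → (g : TreeAut).state v ∈ CT := by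
  refine ⟨(QuotientGroup.eq_one_iff (N := levelStab n) (g : TreeAut)).1
    (congrArg SemidirectProduct.right h), fun v hv => ?_⟩
  have h1 := congrFun (congrArg SemidirectProduct.left h) ⟨v, hv⟩
  exact ⟨_, (QuotientGroup.eq_one_iff (N := C) ⟨(g : TreeAut).state v, state_mem g.2 v⟩).1 h1, rfl⟩

theorem exists_ker_piMap_le (M : Subgroup G) [M.Normal] (hM : M ≠ ⊥) :
    ∃ N : ℕ, ∀ n : ℕ, N ≤ n → (piMap n).ker ≤ M := by
  obtain ⟨g, hg, hne⟩ := M.bot_or_exists_ne_one.resolve_left hM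
  obtain ⟨n, hn⟩ := exists_level_commutator_mem (invariant_map M) ⟨g, hg, rfl⟩
    (fun h => hne (Subtype.ext h))
  refine ⟨n + 4, fun m hm k hk => ?_⟩
  obtain ⟨j, rfl⟩ := Nat.exists_eq_add_of_le hm
  obtain ⟨h1, h2⟩ := piMap_eq_one hk
  have h3 : (k : TreeAut) ∈ M.map G.subtype := by
    refine mem_of_embed_state_mem _ n _ (levelStab_antitone (by omega) h1) fun v hv =>
      hn v hv _ (mem_commutator_KT_KT j _ (mem_levelStab_state (by rwa [← add_assoc]) hv)
        fun w hw => ?_)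
    rw [← state_append]
    exact h2 _ (by rw [List.length_append]; omega)
  obtain ⟨k', hk', h4⟩ := h3
  exact Subtype.ext h4 ▸ hk'

end TwistedTwin

theorem theorem6p1 {Q : Type*} [Group Q] [Finite Q] (f : TwistedTwin.G →* Q)
    (hf : Function.Surjective f) :
    ∃ N : ℕ, ∀ n : ℕ, N ≤ n →
      ∃ h : (TwistedTwin.piMap n).range →* Q,
        h.comp (TwistedTwin.piMap n).rangeRestrict = f := by
  -- A trivial kernel would embed the infinite group `G` in `Q`.
  have hker : f.ker ≠ ⊥ := fun h =>
    have := TwistedTwin.infinite_G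
    not_finite_iff_infinite.2 this (Finite.of_injective f ((MonoidHom.ker_eq_bot_iff f).1 h))
  obtain ⟨N, hN⟩ := TwistedTwin.exists_ker_piMap_le f.ker hker
  refine ⟨N, fun n hn => ?_⟩
  have hle : (TwistedTwin.piMap n).rangeRestrict.ker ≤ f.ker := by
    rw [MonoidHom.ker_rangeRestrict]
    exact hN n hn
  exact ⟨MonoidHom.liftOfSurjective _ (TwistedTwin.piMap n).rangeRestrict_surjective ⟨f, hle⟩,
    MonoidHom.liftOfRightInverse_comp _ _ _ ⟨f, hle⟩⟩
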